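/- Let $1\le \ell\le k$ be integers and let $\pi$ be a probability measure on $\mathbb{R}^k$ with a (measurable) density $\dot\pi:\mathbb{R}^k\to[0,\infty]$ with respect to Lebesgue measure. Let $\mathsf{W}$ be the Stiefel manifold of orthonormal $\ell$-tuples $w=(w_1,\dots,w_\ell)$ in $\mathbb{R}^k$ with its Borel $\sigma$-algebra, and let $\nu$ be a probability measure on $\mathsf{W}$. For $x\in\mathbb{R}^k$ and $w\in\mathsf{W}$ put $\theta(x,w)=x-\sum_{i=1}^\ell (w_i^\top x)w_i$, and let $\varphi_{w,\theta(x,w)}$ be the probability measure on $\mathbb{R}^\ell$ whose density is proportional to $u\mapsto\dot\pi\big(\theta(x,w)+\sum_{i=1}^\ell u_iw_i\big)$, whenever the integral of this function over $\mathbb{R}^\ell$ lies in $(0,\infty)$. (For each $w$ this holds for $\pi$-a.e. $x$; otherwise $\varphi_{w,\theta(x,w)}$ is set to be the point mass at $0$, a choice that is immaterial.) For each $x$ and $w$ let $H_{w,\theta(x,w)}$ be a Markov transition kernel on $\mathbb{R}^\ell$, which depends on $x$ only through $\theta(x,w)$, such that $(x,w,u)\mapsto H_{w,\theta(x,w)}(u,\mathsf{B})$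 is measurable for every Borel set $\mathsf{B}\subset\mathbb{R}^\ell$, and such that $H_{w,\theta(x,w)}$ is reversible with respect to $\varphi_{w,\theta(x,w)}$ whenever the integral above lies in $(0,\infty)$. Define the ideal and the hybrid $\ell$-dimensional hit-and-run kernels on $\mathbb{R}^k$ by $$\bar S(x,\mathsf{A})=\int_{\mathsf{W}}\nu(\mathrm{d}w)\int_{\mathbb{R}^\ell}\varphi_{w,\theta(x,w)}(\mathrm{d}u)\,\mathbf 1_{\mathsf{A}}\Big(\theta(x,w)+\sum_{i=1}^\ell u_iw_i\Big),$$ $$S(x,\mathsf{A})=\int_{\mathsf{W}}\nu(\mathrm{d}w)\int_{\mathbb{R}^\ell}H_{w,\theta(x,w)}\big((w_i^\top x)_{i=1}^\ell,\mathrm{d}u\big)\,\mathbf 1_{\mathsf{A}}\Big(\theta(x,w)+\sum_{i=1}^\ell u_iw_i\Big).$$ For a Markov transition kernel $K$ reversible with respect to a probability measure $\rho$, let $$\mathrm{Gap}(K)=\inf\left\{\frac{\|f\|_\rho^2-\langle f,Kf\rangle_\rho}{\|f\|_\rho^2}:\ f\in L^2(\rho),\ \int f\,\mathrm{d}\rho=0,\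 f\neq0\right\},\qquad Kf(x)=\int f(x')\,K(x,\mathrm{d}x'),$$ be its right spectral gap. Then $S$ and $\bar S$ are both reversible with respect to $\pi$, and $$\mathrm{Gap}(S)\ \ge\ \Big[\operatorname*{ess\,inf}_{w,x}\mathrm{Gap}\big(H_{w,\theta(x,w)}\big)\Big]\,\mathrm{Gap}(\bar S),$$ where the essential infimum is taken with respect to $\nu\times\pi$, and the gap of $H_{w,\theta(x,w)}$ is taken with respect to $\varphi_{w,\theta(x,w)}$. -/

import Mathlib

open MeasureTheory ProbabilityTheory
open scoped ENNReal

noncomputable section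

namespace HitAndRun

/-! ### Right spectral gap of a Markov kernel -/

/-- Nonzero elements of `L₀²(ρ)`, the mean-zero subspace of the real Hilbert space `L²(ρ)`. -/
abbrev NonzeroL20 {Ω : Type*} [MeasurableSpace Ω] (ρ : Measure Ω) : Type _ :=
  {f : Lp ℝ 2 ρ // ∫ x, f x ∂ρ = 0 ∧ f ≠ 0}

/-- The action of a kernel on functions, `K f (x) = ∫ f(x') K(x, dx')`. -/
def kernelOp {Ω : Type*} [MeasurableSpace Ω] (K : Kernel Ω Ω) (f : Ω → ℝ) : Ω → ℝ :=
  fun x => ∫ x', f x' ∂(K x)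

/-- The Dirichlet form `‖f‖² - ⟨f, K f⟩` in `L²(ρ)`. -/
def dirichletForm {Ω : Type*} [MeasurableSpace Ω] (K : Kernel Ω Ω) (ρ : Measure Ω)
    (f : Lp ℝ 2 ρ) : ℝ :=
  ‖f‖ ^ 2 - ∫ x, f x * kernelOp K f x ∂ρ

/-- The right spectral gap: the infimum of `(‖f‖² - ⟨f, K f⟩) / ‖f‖²` over nonzero `f ∈ L₀²(ρ)`.
It is used for Markov kernels `K` reversible with respect to a probability measure `ρ`;
then all the quotients lie in `[0, 2]`. -/
def gap {Ω : Type*} [MeasurableSpace Ω] (K : Kernel Ω Ω) (ρ : Measure Ω) : ℝ :=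
  ⨅ f : NonzeroL20 ρ, dirichletForm K ρ f.1 / ‖f.1‖ ^ 2

/-! ### Geometry -/

/-- The Stiefel manifold of orthonormal `ℓ`-frames in `ℝᵏ`, with the Borel σ-algebra that it
inherits from `(ℝᵏ)^ℓ`. -/
abbrev Stiefel (k ℓ : ℕ) : Type :=
  {w : Fin ℓ → EuclideanSpace ℝ (Fin k) // Orthonormal ℝ w}

variable {k ℓ : ℕ}

/-- The coordinates `(wᵢᵀ x)ᵢ`. -/
def coords (w : Stiefel k ℓ) (x : EuclideanSpace ℝ (Fin k)) : EuclideanSpace ℝ (Fin ℓ) :=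
  WithLp.toLp 2 fun i => inner ℝ (w.1 i) x

/-- `θ(x, w) = x - ∑ᵢ (wᵢᵀ x) wᵢ`. -/
def theta (x : EuclideanSpace ℝ (Fin k)) (w : Stiefel k ℓ) : EuclideanSpace ℝ (Fin k) :=
  x - ∑ i, (inner ℝ (w.1 i) x : ℝ) • w.1 i

/-- The point `y + ∑ᵢ uᵢ wᵢ` of the plane through `y` spanned by the frame `w`. -/
def planePoint (w : Stiefel k ℓ) (y : EuclideanSpace ℝ (Fin k)) (u : EuclideanSpace ℝ (Fin ℓ)) :
    EuclideanSpace ℝ (Fin k) :=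
  y + ∑ i, u i • w.1 i

theorem measurable_coords :
    Measurable fun q : EuclideanSpace ℝ (Fin k) × Stiefel k ℓ => coords q.2 q.1 := by
  have hw (i : Fin ℓ) : Continuous fun q : EuclideanSpace ℝ (Fin k) × Stiefel k ℓ => q.2.1 i :=
    (continuous_apply i).comp (continuous_subtype_val.comp continuous_snd)
  refine Continuous.measurable ?_
  unfold coords
  fun_prop

theorem measurable_theta :
    Measurable fun q : EuclideanSpace ℝ (Fin k) × Stiefel k ℓ => theta q.1 q.2 := by
  have hw (i : Fin ℓ) : Continuous fun q : EuclideanSpace ℝ (Fin k) × Stiefel k ℓ => q.2.1 i :=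
    (continuous_apply i).comp (continuous_subtype_val.comp continuous_snd)
  refine Continuous.measurable ?_
  unfold theta
  fun_prop

theorem measurable_planePoint :
    Measurable fun q : (EuclideanSpace ℝ (Fin k) × Stiefel k ℓ) × EuclideanSpace ℝ (Fin ℓ) =>
      planePoint q.1.2 (theta q.1.1 q.1.2) q.2 := by
  have hw (i : Fin ℓ) : Continuous fun q : (EuclideanSpace ℝ (Fin k) × Stiefel k ℓ) ×
      EuclideanSpace ℝ (Fin ℓ) => q.1.2.1 i :=
    (continuous_apply i).comp (continuous_subtype_val.comp (continuous_snd.comp continuous_fst))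
  refine Continuous.measurable ?_
  unfold planePoint theta
  fun_prop

/-! ### The target restricted to a plane -/

/-- The normalizing constant `∫ p(y + ∑ᵢ uᵢ wᵢ) du` over `ℝ^ℓ`. -/
def planeMass (p : EuclideanSpace ℝ (Fin k) → ℝ≥0∞) (w : Stiefel k ℓ)
    (y : EuclideanSpace ℝ (Fin k)) : ℝ≥0∞ :=
  ∫⁻ u, p (planePoint w y u)

/-- The normalizing constant lies in `(0, ∞)`. -/
def GoodPlane (p : EuclideanSpace ℝ (Fin k) → ℝ≥0∞) (w : Stiefel k ℓ)
    (y : EuclideanSpace ℝ (Fin k)) : Prop :=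
  0 < planeMass p w y ∧ planeMass p w y < ∞

open Classical in
/-- The probability measure `φ_{w,y}` on `ℝ^ℓ` with density proportional to
`u ↦ p(y + ∑ᵢ uᵢ wᵢ)`. Where the normalizing constant is not in `(0, ∞)`, so that this makes no
sense, it is the point mass at `0`. For each `w` this concerns only a null set of points
`x ~ π`, and it only serves to make the ideal kernel total. -/
def planeMeasure (p : EuclideanSpace ℝ (Fin k) → ℝ≥0∞) (w : Stiefel k ℓ)
    (y : EuclideanSpace ℝ (Fin k)) : Measure (EuclideanSpace ℝ (Fin ℓ)) :=
  if GoodPlane p w y then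
    (planeMass p w y)⁻¹ • volume.withDensity fun u => p (planePoint w y u)
  else Measure.dirac 0

instance isProbabilityMeasure_planeMeasure (p : EuclideanSpace ℝ (Fin k) → ℝ≥0∞)
    (w : Stiefel k ℓ) (y : EuclideanSpace ℝ (Fin k)) :
    IsProbabilityMeasure (planeMeasure p w y) := by
  unfold planeMeasure
  split_ifs with h
  · constructor
    rw [Measure.smul_apply, withDensity_apply _ MeasurableSet.univ, Measure.restrict_univ,
      smul_eq_mul]
    exact ENNReal.inv_mul_cancel h.1.ne' h.2.ne
  · infer_instance

theorem measurable_planeMeasure {p : EuclideanSpace ℝ (Fin k) → ℝ≥0∞} (hp : Measurable p) :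
    Measurable fun q : EuclideanSpace ℝ (Fin k) × Stiefel k ℓ =>
      planeMeasure p q.2 (theta q.1 q.2) := by
  classical
  have hm : Measurable fun q : EuclideanSpace ℝ (Fin k) × Stiefel k ℓ =>
      planeMass p q.2 (theta q.1 q.2) :=
    Measurable.lintegral_prod_right' (hp.comp measurable_planePoint)
  have hg : MeasurableSet {q : EuclideanSpace ℝ (Fin k) × Stiefel k ℓ |
      GoodPlane p q.2 (theta q.1 q.2)} :=
    (measurableSet_lt measurable_const hm).inter (measurableSet_lt hm measurable_const)
  unfold planeMeasure
  refine Measurable.ite hg ?_ measurable_const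
  refine Measure.measurable_of_measurable_coe _ fun s hs => ?_
  simp only [Measure.smul_apply, withDensity_apply _ hs, smul_eq_mul]
  exact hm.inv.mul (Measurable.lintegral_prod_right' (hp.comp measurable_planePoint))

/-! ### The samplers -/

/-- Draw `w ~ ν`, then `u ~ κ(x, w)`, and move from `x` to `θ(x, w) + ∑ᵢ uᵢ wᵢ`; here `κ` is a
Markov kernel from `ℝᵏ × W` to `ℝ^ℓ`. -/
def planeMove (ν : Measure (Stiefel k ℓ)) [IsProbabilityMeasure ν]
    (κ : Kernel (EuclideanSpace ℝ (Fin k) × Stiefel k ℓ) (EuclideanSpace ℝ (Fin ℓ)))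
    [IsMarkovKernel κ] : Kernel (EuclideanSpace ℝ (Fin k)) (EuclideanSpace ℝ (Fin k)) :=
  ((Kernel.id ×ₖ κ).map fun q => planePoint q.1.2 (theta q.1.1 q.1.2) q.2) ∘ₖ
    (Kernel.id ×ₖ Kernel.const _ ν)

instance isMarkovKernel_planeMove (ν : Measure (Stiefel k ℓ)) [IsProbabilityMeasure ν]
    (κ : Kernel (EuclideanSpace ℝ (Fin k) × Stiefel k ℓ) (EuclideanSpace ℝ (Fin ℓ)))
    [IsMarkovKernel κ] : IsMarkovKernel (planeMove ν κ) := by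
  have := Kernel.IsMarkovKernel.map (Kernel.id ×ₖ κ) (measurable_planePoint (k := k) (ℓ := ℓ))
  unfold planeMove
  infer_instance

/-- The defining formula
`∫ ν(dw) ∫ κ((x, w), du) 1_A(θ(x, w) + ∑ᵢ uᵢ wᵢ)` of the kernel `planeMove ν κ`. -/
theorem planeMove_apply (ν : Measure (Stiefel k ℓ)) [IsProbabilityMeasure ν]
    (κ : Kernel (EuclideanSpace ℝ (Fin k) × Stiefel k ℓ) (EuclideanSpace ℝ (Fin ℓ)))
    [IsMarkovKernel κ] (x : EuclideanSpace ℝ (Fin k)) {A : Set (EuclideanSpace ℝ (Fin k))}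
    (hA : MeasurableSet A) :
    planeMove ν κ x A =
      ∫⁻ w, ∫⁻ u, A.indicator 1 (planePoint w (theta x w) u) ∂(κ (x, w)) ∂ν := by
  have hm := measurable_planePoint (k := k) (ℓ := ℓ)
  have hf : Measurable (A.indicator (1 : EuclideanSpace ℝ (Fin k) → ℝ≥0∞)) :=
    measurable_one.indicator hA
  rw [← lintegral_indicator_one hA, planeMove, Kernel.lintegral_comp _ _ _ hf,
    Kernel.lintegral_id_prod (hf.lintegral_kernel)]
  simp only [Kernel.const_apply]
  refine lintegral_congr fun w => ?_
  rw [Kernel.lintegral_map _ hm _ hf]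
  exact Kernel.lintegral_id_prod (hf.comp hm) κ (x, w)

/-- The kernel `(x, w) ↦ φ_{w,θ(x,w)}`. -/
def planeKernel (p : EuclideanSpace ℝ (Fin k) → ℝ≥0∞) (hp : Measurable p) :
    Kernel (EuclideanSpace ℝ (Fin k) × Stiefel k ℓ) (EuclideanSpace ℝ (Fin ℓ)) :=
  ⟨fun q => planeMeasure p q.2 (theta q.1 q.2), measurable_planeMeasure hp⟩

instance isMarkovKernel_planeKernel (p : EuclideanSpace ℝ (Fin k) → ℝ≥0∞) (hp : Measurable p) :
    IsMarkovKernel (planeKernel (ℓ := ℓ) p hp) :=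
  ⟨fun q => isProbabilityMeasure_planeMeasure p q.2 (theta q.1 q.2)⟩

/-- The ideal `ℓ`-dimensional hit-and-run kernel
`S̄(x, A) = ∫ ν(dw) ∫ φ_{w,θ(x,w)}(du) 1_A(θ(x,w) + ∑ᵢ uᵢ wᵢ)` for the target density `p`. -/
def idealHitAndRun (ν : Measure (Stiefel k ℓ)) [IsProbabilityMeasure ν]
    (p : EuclideanSpace ℝ (Fin k) → ℝ≥0∞) (hp : Measurable p) :
    Kernel (EuclideanSpace ℝ (Fin k)) (EuclideanSpace ℝ (Fin k)) :=
  planeMove ν (planeKernel p hp)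

/-- Joint measurability of `(x, w, u) ↦ H_{w,θ(x,w)}(u, B)` for every measurable `B`. -/
def JointlyMeasurable
    (H : Stiefel k ℓ → EuclideanSpace ℝ (Fin k) →
      Kernel (EuclideanSpace ℝ (Fin ℓ)) (EuclideanSpace ℝ (Fin ℓ))) : Prop :=
  ∀ B : Set (EuclideanSpace ℝ (Fin ℓ)), MeasurableSet B →
    Measurable fun q : EuclideanSpace ℝ (Fin k) × Stiefel k ℓ × EuclideanSpace ℝ (Fin ℓ) =>
      H q.2.1 (theta q.1 q.2.1) q.2.2 B

/-- The kernel `(x, w) ↦ H_{w,θ(x,w)}((wᵢᵀ x)ᵢ, ·)`. -/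
def hybridKernel
    (H : Stiefel k ℓ → EuclideanSpace ℝ (Fin k) →
      Kernel (EuclideanSpace ℝ (Fin ℓ)) (EuclideanSpace ℝ (Fin ℓ)))
    (hHmeas : JointlyMeasurable H) :
    Kernel (EuclideanSpace ℝ (Fin k) × Stiefel k ℓ) (EuclideanSpace ℝ (Fin ℓ)) :=
  ⟨fun q => H q.2 (theta q.1 q.2) (coords q.2 q.1),
    Measure.measurable_of_measurable_coe _ fun B hB =>
      (hHmeas B hB).comp (measurable_fst.prodMk (measurable_snd.prodMk measurable_coords))⟩

theorem isMarkovKernel_hybridKernel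
    (H : Stiefel k ℓ → EuclideanSpace ℝ (Fin k) →
      Kernel (EuclideanSpace ℝ (Fin ℓ)) (EuclideanSpace ℝ (Fin ℓ)))
    (hHprob : ∀ w x, IsMarkovKernel (H w (theta x w))) (hHmeas : JointlyMeasurable H) :
    IsMarkovKernel (hybridKernel H hHmeas) :=
  ⟨fun q => (hHprob q.2 q.1).isProbabilityMeasure (coords q.2 q.1)⟩

/-- The hybrid hit-and-run kernel
`S(x, A) = ∫ ν(dw) ∫ H_{w,θ(x,w)}((wᵢᵀ x)ᵢ, du) 1_A(θ(x,w) + ∑ᵢ uᵢ wᵢ)`. -/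
def hybridHitAndRun (ν : Measure (Stiefel k ℓ)) [IsProbabilityMeasure ν]
    (H : Stiefel k ℓ → EuclideanSpace ℝ (Fin k) →
      Kernel (EuclideanSpace ℝ (Fin ℓ)) (EuclideanSpace ℝ (Fin ℓ)))
    (hHprob : ∀ w x, IsMarkovKernel (H w (theta x w))) (hHmeas : JointlyMeasurable H) :
    Kernel (EuclideanSpace ℝ (Fin k)) (EuclideanSpace ℝ (Fin k)) :=
  have := isMarkovKernel_hybridKernel H hHprob hHmeas
  planeMove ν (hybridKernel H hHmeas)

theorem idealHitAndRun_apply (ν : Measure (Stiefel k ℓ)) [IsProbabilityMeasure ν]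
    (p : EuclideanSpace ℝ (Fin k) → ℝ≥0∞) (hp : Measurable p)
    (x : EuclideanSpace ℝ (Fin k)) {A : Set (EuclideanSpace ℝ (Fin k))} (hA : MeasurableSet A) :
    idealHitAndRun ν p hp x A =
      ∫⁻ w, ∫⁻ u, A.indicator 1 (planePoint w (theta x w) u)
        ∂(planeMeasure p w (theta x w)) ∂ν := by
  exact planeMove_apply ν (planeKernel p hp) x hA

theorem hybridHitAndRun_apply (ν : Measure (Stiefel k ℓ)) [IsProbabilityMeasure ν]
    (H : Stiefel k ℓ → EuclideanSpace ℝ (Fin k) →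
      Kernel (EuclideanSpace ℝ (Fin ℓ)) (EuclideanSpace ℝ (Fin ℓ)))
    (hHprob : ∀ w x, IsMarkovKernel (H w (theta x w))) (hHmeas : JointlyMeasurable H)
    (x : EuclideanSpace ℝ (Fin k)) {A : Set (EuclideanSpace ℝ (Fin k))} (hA : MeasurableSet A) :
    hybridHitAndRun ν H hHprob hHmeas x A =
      ∫⁻ w, ∫⁻ u, A.indicator 1 (planePoint w (theta x w) u)
        ∂(H w (theta x w) (coords w x)) ∂ν := by
  have := isMarkovKernel_hybridKernel H hHprob hHmeas
  exact planeMove_apply ν (hybridKernel H hHmeas) x hA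

end HitAndRun

end

/-! For a kernel with invariant law `ρ`, twice the Dirichlet form of `f` is the mean squared
increment of `f` along one stationary step (`energy_eq_ofReal_dirichletForm`), and this can be
computed plane by plane. Fix a frame `w` and let `x ~ π`: conditionally on `theta x w`, the
coordinates of `x` follow `planeMeasure` (`lintegral_theta_coords`), so a stationary step of `S` is
a stationary step of `H` in a random plane (`lintegral_lintegral_hybridHitAndRun`).

Applied to products of indicators, this transfers reversibility from `H` to `S`. Applied to squared
increments, it makes the energy of `S` the average over planes of the energies of `H`
(`energy_hybridHitAndRun`). The ideal sampler is the case where `H` forgets its position and draws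
afresh from `planeMeasure`; its energy in a plane is twice the variance. In almost every plane the
Poincaré inequality bounds the energy of `H` below by `γ` times that quantity
(`mul_energy_const_le_energy`), where `γ` is the essential infimum of the gaps. Averaging over
planes compares the energies of `S` and `S̄`, hence their gaps (`mul_gap_le_gap`). -/

noncomputable section

namespace HitAndRun

/-! ### Dirichlet forms as mean squared increments, and the Poincaré inequality. -/

section Energy

variable {Ω : Type*} [MeasurableSpace Ω] {K : Kernel Ω Ω} {ρ : Measure Ω}

/-- The expected squared increment `∫ ρ(dx) ∫ K(x, dx') |f x - f x'|²`, twice the Dirichlet form. -/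
def energy (K : Kernel Ω Ω) (ρ : Measure Ω) (f : Ω → ℝ) : ℝ≥0∞ :=
  ∫⁻ x, ∫⁻ x', ‖f x - f x'‖ₑ ^ 2 ∂K x ∂ρ

theorem measurePreserving_fst_compProd [SFinite ρ] [IsMarkovKernel K] :
    MeasurePreserving Prod.fst (ρ ⊗ₘ K) ρ :=
  ⟨measurable_fst, Measure.fst_compProd ρ K⟩

theorem measurePreserving_snd_compProd [SFinite ρ] [IsMarkovKernel K] (hK : K.Invariant ρ) :
    MeasurePreserving Prod.snd (ρ ⊗ₘ K) ρ :=
  ⟨measurable_snd, (Measure.snd_compProd ρ K).trans hK⟩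

theorem energy_eq_lintegral_compProd [SFinite ρ] [IsMarkovKernel K] {f : Ω → ℝ}
    (hf : Measurable f) : energy K ρ f = ∫⁻ z, ‖f z.1 - f z.2‖ₑ ^ 2 ∂(ρ ⊗ₘ K) := by
  rw [Measure.lintegral_compProd (by fun_prop)]
  rfl

theorem energy_sub_const (f : Ω → ℝ) (c : ℝ) :
    energy K ρ (fun x => f x - c) = energy K ρ f := by
  simp [energy]

/-- Invariance is what lets a null set be ignored at the end of the step as well as at its start. -/
theorem energy_congr_ae [SFinite ρ] [IsMarkovKernel K] (hK : K.Invariant ρ) {f g : Ω → ℝ}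
    (hf : Measurable f) (hg : Measurable g) (h : f =ᵐ[ρ] g) : energy K ρ f = energy K ρ g := by
  rw [energy_eq_lintegral_compProd hf, energy_eq_lintegral_compProd hg]
  refine lintegral_congr_ae ?_
  filter_upwards [measurePreserving_fst_compProd.quasiMeasurePreserving.ae h,
    (measurePreserving_snd_compProd hK).quasiMeasurePreserving.ae h] with z h₁ h₂
  rw [h₁, h₂]

theorem norm_sq_eq_integral (f : Lp ℝ 2 ρ) : ‖f‖ ^ 2 = ∫ x, f x ^ 2 ∂ρ := by
  have h := real_inner_self_eq_norm_sq f
  rw [← h, L2.inner_def]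
  simp [sq]

/-- Expand the square: both marginals of `ρ ⊗ₘ K` are `ρ`, so each square contributes `‖f‖ ^ 2`.
Invariance suffices here; reversibility does not enter. -/
theorem two_mul_dirichletForm [SFinite ρ] [IsMarkovKernel K] (hK : K.Invariant ρ)
    (f : Lp ℝ 2 ρ) :
    2 * dirichletForm K ρ f = ∫ z, (f z.1 - f z.2) ^ 2 ∂(ρ ⊗ₘ K) := by
  have hf := Lp.memLp f
  have h₁ := measurePreserving_fst_compProd (ρ := ρ) (K := K)
  have h₂ := measurePreserving_snd_compProd hK
  have m₁ := hf.comp_measurePreserving h₁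
  have m₂ := hf.comp_measurePreserving h₂
  have hq (q : Ω × Ω → Ω) (hq : MeasurePreserving q (ρ ⊗ₘ K) ρ) :
      ∫ z, f (q z) ^ 2 ∂(ρ ⊗ₘ K) = ‖f‖ ^ 2 := by
    have h := integral_map (μ := ρ ⊗ₘ K) hq.measurable.aemeasurable (f := fun x => f x ^ 2)
      (by rw [hq.map_eq]; exact hf.1.pow 2)
    rw [hq.map_eq] at h
    rw [norm_sq_eq_integral, h]
  have hm : Integrable (fun z : Ω × Ω => f z.1 * f z.2) (ρ ⊗ₘ K) := m₁.integrable_mul m₂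
  have i₃ : ∫ z, f z.1 * f z.2 ∂(ρ ⊗ₘ K) = ∫ x, f x * kernelOp K f x ∂ρ := by
    rw [Measure.integral_compProd hm]
    simp only [integral_const_mul, kernelOp]
  have e : (fun z : Ω × Ω => (f z.1 - f z.2) ^ 2) =
      fun z => f z.1 ^ 2 + f z.2 ^ 2 - 2 * (f z.1 * f z.2) := by
    ext z; ring
  have s₁ : Integrable (fun z : Ω × Ω => f z.1 ^ 2) (ρ ⊗ₘ K) := m₁.integrable_sq
  have s₂ : Integrable (fun z : Ω × Ω => f z.2 ^ 2) (ρ ⊗ₘ K) := m₂.integrable_sq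
  have s₁₂ : Integrable (fun z : Ω × Ω => f z.1 ^ 2 + f z.2 ^ 2) (ρ ⊗ₘ K) := s₁.add s₂
  rw [e, integral_sub s₁₂ (hm.const_mul 2), integral_add s₁ s₂, integral_const_mul,
    hq _ h₁, hq _ h₂, i₃, dirichletForm]
  ring

theorem dirichletForm_nonneg [SFinite ρ] [IsMarkovKernel K] (hK : K.Invariant ρ)
    (f : Lp ℝ 2 ρ) : 0 ≤ dirichletForm K ρ f := by
  have h := two_mul_dirichletForm hK f
  have : 0 ≤ ∫ z, (f z.1 - f z.2) ^ 2 ∂(ρ ⊗ₘ K) := integral_nonneg fun z => sq_nonneg _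
  linarith

theorem energy_eq_ofReal_dirichletForm [SFinite ρ] [IsMarkovKernel K] (hK : K.Invariant ρ)
    (f : Lp ℝ 2 ρ) : energy K ρ f = ENNReal.ofReal (2 * dirichletForm K ρ f) := by
  have hf := Lp.memLp f
  have m₁ := hf.comp_measurePreserving (measurePreserving_fst_compProd (K := K))
  have m₂ := hf.comp_measurePreserving (measurePreserving_snd_compProd hK)
  have hi : Integrable (fun z : Ω × Ω => (f z.1 - f z.2) ^ 2) (ρ ⊗ₘ K) :=
    (m₁.sub m₂).integrable_sq
  rw [two_mul_dirichletForm hK, energy_eq_lintegral_compProd (Lp.stronglyMeasurable f).measurable,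
    ofReal_integral_eq_lintegral_ofReal hi (Filter.Eventually.of_forall fun z => sq_nonneg _)]
  refine lintegral_congr fun z => ?_
  rw [← enorm_pow, Real.enorm_of_nonneg (sq_nonneg _)]

theorem bddBelow_rayleigh [SFinite ρ] [IsMarkovKernel K] (hK : K.Invariant ρ) :
    BddBelow (Set.range fun f : NonzeroL20 ρ => dirichletForm K ρ f.1 / ‖f.1‖ ^ 2) :=
  ⟨0, by
    rintro _ ⟨f, rfl⟩
    exact div_nonneg (dirichletForm_nonneg hK f.1) (sq_nonneg _)⟩

theorem gap_nonneg [SFinite ρ] [IsMarkovKernel K] (hK : K.Invariant ρ) : 0 ≤ gap K ρ :=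
  Real.iInf_nonneg fun f => div_nonneg (dirichletForm_nonneg hK f.1) (sq_nonneg _)

theorem gap_mul_norm_sq_le_dirichletForm [SFinite ρ] [IsMarkovKernel K] (hK : K.Invariant ρ)
    (f : Lp ℝ 2 ρ) (hf : ∫ x, f x ∂ρ = 0) : gap K ρ * ‖f‖ ^ 2 ≤ dirichletForm K ρ f := by
  by_cases h0 : f = 0
  · simpa [h0] using dirichletForm_nonneg hK (0 : Lp ℝ 2 ρ)
  · have h := ciInf_le (bddBelow_rayleigh hK) ⟨f, hf, h0⟩
    rwa [le_div_iff₀ (pow_pos (norm_pos_iff.2 h0) 2)] at h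

theorem invariant_const [IsProbabilityMeasure ρ] : (Kernel.const Ω ρ).Invariant ρ := by
  simp [Kernel.Invariant]

theorem dirichletForm_const (f : Lp ℝ 2 ρ) (hf : ∫ x, f x ∂ρ = 0) :
    dirichletForm (Kernel.const Ω ρ) ρ f = ‖f‖ ^ 2 := by
  simp [dirichletForm, kernelOp, hf]

/-- The Poincaré inequality expressed by the spectral gap. -/
theorem mul_energy_const_le_energy [IsProbabilityMeasure ρ] [IsMarkovKernel K]
    (hK : K.Invariant ρ) {γ : ℝ} (hγ0 : 0 ≤ γ) (hγ : γ ≤ gap K ρ) {g : Ω → ℝ} (hgm : Measurable g)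
    (hg : MemLp g 2 ρ) :
    ENNReal.ofReal γ * energy (Kernel.const Ω ρ) ρ g ≤ energy K ρ g := by
  -- The gap only controls mean-zero functions. Centering `g` costs nothing, since energies see only
  -- increments.
  set c := ∫ x, g x ∂ρ
  have hgc : MemLp (fun x => g x - c) 2 ρ := hg.sub (memLp_const c)
  have hint : Integrable g ρ := hg.integrable one_le_two
  set f : Lp ℝ 2 ρ := hgc.toLp _
  have hfg : f =ᵐ[ρ] fun x => g x - c := hgc.coeFn_toLp
  have hf0 : ∫ x, f x ∂ρ = 0 := by
    rw [integral_congr_ae hfg, integral_sub hint (integrable_const _)]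
    simp [c]
  have hfm : Measurable f := (Lp.stronglyMeasurable f).measurable
  have key (L : Kernel Ω Ω) [IsMarkovKernel L] (hL : L.Invariant ρ) :
      energy L ρ g = ENNReal.ofReal (2 * dirichletForm L ρ f) := by
    rw [← energy_eq_ofReal_dirichletForm hL, ← energy_sub_const g c,
      energy_congr_ae hL hfm (hgm.sub_const c) hfg]
  rw [key K hK, key _ invariant_const, ← ENNReal.ofReal_mul hγ0, dirichletForm_const f hf0]
  refine ENNReal.ofReal_le_ofReal ?_
  have h₁ := gap_mul_norm_sq_le_dirichletForm hK f hf0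
  have h₂ := mul_le_mul_of_nonneg_right hγ (sq_nonneg ‖f‖)
  linarith

/-- A comparison of energies gives a comparison of spectral gaps. -/
theorem mul_gap_le_gap [IsProbabilityMeasure ρ] [IsMarkovKernel K] {L : Kernel Ω Ω}
    [IsMarkovKernel L] (hK : K.Invariant ρ) (hL : L.Invariant ρ) {γ : ℝ} (hγ0 : 0 ≤ γ)
    (h : ∀ f : Lp ℝ 2 ρ, ENNReal.ofReal γ * energy L ρ f ≤ energy K ρ f) :
    γ * gap L ρ ≤ gap K ρ := by
  -- If `L₀²(ρ)` is trivial, both gaps are infima over the empty set, which are `0` in `ℝ`.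
  rcases isEmpty_or_nonempty (NonzeroL20 ρ) with he | hne
  · simp [gap, Real.iInf_of_isEmpty]
  · refine le_ciInf fun f => ?_
    have hpos : 0 < ‖f.1‖ ^ 2 := pow_pos (norm_pos_iff.2 f.2.2) 2
    rw [le_div_iff₀ hpos]
    have h₁ := h f.1
    rw [energy_eq_ofReal_dirichletForm hK, energy_eq_ofReal_dirichletForm hL,
      ← ENNReal.ofReal_mul hγ0, ENNReal.ofReal_le_ofReal_iff
        (mul_nonneg zero_le_two (dirichletForm_nonneg hK f.1))] at h₁
    have h₂ := mul_le_mul_of_nonneg_left (gap_mul_norm_sq_le_dirichletForm hL f.1 f.2.1) hγ0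
    linarith

end Energy

/-! ### Disintegration of Lebesgue measure and of the target along parallel planes. -/

section Plane

variable {k ℓ : ℕ} (w : Stiefel k ℓ)

theorem inner_frame_theta (x : EuclideanSpace ℝ (Fin k)) (i : Fin ℓ) :
    inner ℝ (w.1 i) (theta x w) = 0 := by
  rw [theta, inner_sub_right, w.2.inner_right_fintype, sub_self]

theorem coords_theta (x : EuclideanSpace ℝ (Fin k)) : coords w (theta x w) = 0 := by
  ext i
  exact inner_frame_theta w x i

theorem coords_planePoint (x : EuclideanSpace ℝ (Fin k)) (u : EuclideanSpace ℝ (Fin ℓ)) :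
    coords w (planePoint w x u) = coords w x + u := by
  ext i
  simp [coords, planePoint, inner_add_right, w.2.inner_right_fintype]

theorem planePoint_planePoint (x : EuclideanSpace ℝ (Fin k)) (u v : EuclideanSpace ℝ (Fin ℓ)) :
    planePoint w (planePoint w x u) v = planePoint w x (u + v) := by
  simp [planePoint, add_smul, Finset.sum_add_distrib, add_assoc]

theorem planePoint_theta_coords (x : EuclideanSpace ℝ (Fin k)) :
    planePoint w (theta x w) (coords w x) = x := by
  simp [planePoint, theta, coords]

theorem theta_planePoint (x : EuclideanSpace ℝ (Fin k)) (u : EuclideanSpace ℝ (Fin ℓ)) :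
    theta (planePoint w x u) w = theta x w := by
  simp [theta, planePoint, inner_add_right, w.2.inner_right_fintype, add_smul,
    Finset.sum_add_distrib]

theorem theta_theta (x : EuclideanSpace ℝ (Fin k)) : theta (theta x w) w = theta x w := by
  rw [← theta_planePoint w (theta x w) (coords w x), planePoint_theta_coords]

theorem continuous_planePoint_uncurry :
    Continuous fun q : EuclideanSpace ℝ (Fin k) × EuclideanSpace ℝ (Fin ℓ) =>
      planePoint w q.1 q.2 := by
  unfold planePoint
  fun_prop

@[fun_prop]
theorem Measurable.planePoint {α : Type*} [MeasurableSpace α]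
    {f : α → EuclideanSpace ℝ (Fin k)} {g : α → EuclideanSpace ℝ (Fin ℓ)} (hf : Measurable f)
    (hg : Measurable g) : Measurable fun a => planePoint w (f a) (g a) :=
  (continuous_planePoint_uncurry w).measurable.comp (hf.prodMk hg)

@[fun_prop]
theorem measurable_theta_left : Measurable fun x => theta x w := by
  unfold theta
  fun_prop

@[fun_prop]
theorem measurable_coords_right : Measurable fun x => coords w x := by
  unfold coords
  fun_prop

/-- Integration over space by integrating over the planes in the direction of a frame. -/
theorem lintegral_mul_lintegral_eq_lintegral_planes {g : EuclideanSpace ℝ (Fin ℓ) → ℝ≥0∞}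
    (hg : Measurable g) {h : EuclideanSpace ℝ (Fin k) → ℝ≥0∞} (hh : Measurable h) :
    (∫⁻ u, g u) * ∫⁻ x, h x =
      ∫⁻ x, g (coords w x) * ∫⁻ u, h (planePoint w (theta x w) u) := by
  -- Fubini and translation invariance replace an orthogonal change of variables: moving `x` by `∑
  -- i, u i • w.1 i` shifts its coordinates by `u`, cancelling the shift inside `g`. The weight `g`
  -- compensates for integrating over all `x` instead of over the orthogonal complement of the
  -- frame.
  calc (∫⁻ u, g u) * ∫⁻ x, h x
      = ∫⁻ x, ∫⁻ u, g (coords w x - u) * h x := by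
        rw [← lintegral_const_mul _ hh]
        refine lintegral_congr fun x => ?_
        rw [lintegral_mul_const _ (by fun_prop), lintegral_sub_left_eq_self]
    _ = ∫⁻ u, ∫⁻ x, g (coords w x - u) * h x :=
        lintegral_lintegral_swap (by unfold Function.uncurry; fun_prop)
    _ = ∫⁻ u, ∫⁻ x, g (coords w x) * h (planePoint w x u) := by
        refine lintegral_congr fun u => ?_
        rw [← lintegral_add_right_eq_self _ (∑ i, u i • w.1 i)]
        refine lintegral_congr fun x => ?_
        change g (coords w (planePoint w x u) - u) * h (planePoint w x u) = _
        rw [coords_planePoint, add_sub_cancel_right]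
    _ = ∫⁻ x, ∫⁻ u, g (coords w x) * h (planePoint w x u) :=
        lintegral_lintegral_swap (by unfold Function.uncurry; fun_prop)
    _ = _ := by
        refine lintegral_congr fun x => ?_
        rw [lintegral_const_mul _ (by fun_prop),
          ← lintegral_add_left_eq_self (fun u => h (planePoint w (theta x w) u)) (coords w x)]
        simp_rw [← planePoint_planePoint, planePoint_theta_coords]

variable {p : EuclideanSpace ℝ (Fin k) → ℝ≥0∞}

/-- Supplies the weight for the plane formula: a finite nonzero integral can be cancelled, and
positivity everywhere lets finiteness of `g * planeMass` pass to `planeMass`. -/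
theorem exists_plane_weight : ∃ g : EuclideanSpace ℝ (Fin ℓ) → ℝ≥0∞, Measurable g ∧
    (∀ u, g u ≠ 0) ∧ ∫⁻ u, g u ≠ 0 ∧ ∫⁻ u, g u ≠ ∞ := by
  obtain ⟨g, hpos, hm, hlt⟩ := exists_pos_lintegral_lt_of_sigmaFinite
    (volume : Measure (EuclideanSpace ℝ (Fin ℓ))) (ε := 1) one_ne_zero
  have hne (u) : (g u : ℝ≥0∞) ≠ 0 := by exact_mod_cast (hpos u).ne'
  refine ⟨fun u => g u, hm.coe_nnreal_ennreal, hne, fun h0 => ?_, (hlt.trans ENNReal.one_lt_top).ne⟩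
  rw [lintegral_eq_zero_iff hm.coe_nnreal_ennreal] at h0
  obtain ⟨u, hu⟩ := h0.exists
  exact hne u hu

theorem measurable_planeMass (hp : Measurable p) :
    Measurable fun x => planeMass p w (theta x w) :=
  Measurable.lintegral_prod_right' (f := fun q : _ × _ => p (planePoint w (theta q.1 w) q.2))
    (by fun_prop)

theorem ae_planeMass_lt_top (hp : Measurable p) (hfin : ∫⁻ x, p x ≠ ∞) :
    ∀ᵐ x, planeMass p w (theta x w) < ∞ := by
  obtain ⟨g, hg, hg0, -, hgt⟩ := exists_plane_weight (ℓ := ℓ)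
  have h := lintegral_mul_lintegral_eq_lintegral_planes w hg hp
  have hm := measurable_planeMass w hp
  have hlt : ∀ᵐ x, g (coords w x) * planeMass p w (theta x w) < ∞ :=
    ae_lt_top ((hg.comp (measurable_coords_right w)).mul hm)
      (h ▸ ENNReal.mul_ne_top hgt hfin)
  filter_upwards [hlt] with x hx
  by_contra htop
  rw [not_lt_top_iff.1 htop, ENNReal.mul_top (hg0 _)] at hx
  exact lt_irrefl _ hx

theorem ae_goodPlane (hp : Measurable p) (hfin : ∫⁻ x, p x ≠ ∞) :
    ∀ᵐ x ∂volume.withDensity p, GoodPlane p w (theta x w) := by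
  have hm := measurable_planeMass w hp
  have htop := (withDensity_absolutelyContinuous volume p).ae_le (ae_planeMass_lt_top w hp hfin)
  obtain ⟨g, hg, -, hgc, -⟩ := exists_plane_weight (ℓ := ℓ)
  have hs : MeasurableSet {x | planeMass p w (theta x w) = 0} := hm (measurableSet_singleton 0)
  have h0 : ∀ᵐ x ∂volume.withDensity p, ¬ planeMass p w (theta x w) = 0 := by
    rw [ae_iff]
    simp only [not_not]
    rw [withDensity_apply _ hs, ← lintegral_indicator hs]
    -- The set where the mass vanishes is a union of whole planes, since the mass depends on `x`
    -- only through `theta x w`. So `p` restricted to it has integral zero over every plane.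
    have h := lintegral_mul_lintegral_eq_lintegral_planes w hg (hp.indicator hs)
    have hz : ∫⁻ x, g (coords w x) * ∫⁻ u, Set.indicator {x | planeMass p w (theta x w) = 0} p
        (planePoint w (theta x w) u) = 0 := by
      refine (lintegral_congr fun x => ?_).trans lintegral_zero
      by_cases hx : planeMass p w (theta x w) = 0
      · simp only [Set.indicator, Set.mem_ofPred_eq, theta_planePoint, theta_theta, hx, if_true]
        exact mul_eq_zero_of_right _ hx
      · simp [Set.indicator, theta_planePoint, theta_theta, hx]
    rw [hz] at h
    exact (mul_eq_zero.1 h).resolve_left hgc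
  filter_upwards [htop, h0] with x h₁ h₂
  exact ⟨pos_iff_ne_zero.2 h₂, h₁⟩

/-- In this multiplied form mass zero is allowed: both sides then vanish, whatever the default value
of `planeMeasure`. -/
theorem planeMass_mul_lintegral_planeMeasure (hp : Measurable p)
    {y : EuclideanSpace ℝ (Fin k)} (hy : planeMass p w y < ∞)
    {F : EuclideanSpace ℝ (Fin ℓ) → ℝ≥0∞} (hF : Measurable F) :
    planeMass p w y * ∫⁻ u, F u ∂planeMeasure p w y = ∫⁻ u, p (planePoint w y u) * F u := by
  have hpm : Measurable fun u => p (planePoint w y u) := by fun_prop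
  by_cases h0 : planeMass p w y = 0
  · rw [h0, zero_mul]
    symm
    rw [planeMass, lintegral_eq_zero_iff hpm] at h0
    refine lintegral_eq_zero_of_ae_eq_zero ?_
    filter_upwards [h0] with u hu
    exact mul_eq_zero_of_left hu _
  · have hg : GoodPlane p w y := ⟨pos_iff_ne_zero.2 h0, hy⟩
    rw [planeMeasure, if_pos hg, lintegral_smul_measure,
      lintegral_withDensity_eq_lintegral_mul _ hpm hF, smul_eq_mul, ← mul_assoc,
      ENNReal.mul_inv_cancel h0 hy.ne, one_mul]
    rfl

theorem measurable_lintegral_planeMeasure (hp : Measurable p)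
    {F : EuclideanSpace ℝ (Fin k) → EuclideanSpace ℝ (Fin ℓ) → ℝ≥0∞}
    (hF : Measurable (Function.uncurry F)) :
    Measurable fun x => ∫⁻ u, F x u ∂planeMeasure p w (theta x w) :=
  hF.lintegral_kernel_prod_right (κ := (planeKernel p hp).comap (fun x => (x, w))
    (by fun_prop))

/-- Given the projection `theta x w`, the coordinates of `x ~ p` follow `planeMeasure`. -/
theorem lintegral_theta_coords (hp : Measurable p) (hfin : ∫⁻ x, p x ≠ ∞)
    {F : EuclideanSpace ℝ (Fin k) → EuclideanSpace ℝ (Fin ℓ) → ℝ≥0∞}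
    (hF : Measurable (Function.uncurry F)) :
    ∫⁻ x, F (theta x w) (coords w x) ∂volume.withDensity p =
      ∫⁻ x, ∫⁻ u, F (theta x w) u ∂planeMeasure p w (theta x w) ∂volume.withDensity p := by
  obtain ⟨g, hg, -, hg0, hgt⟩ := exists_plane_weight (ℓ := ℓ)
  have hFc : Measurable fun x => F (theta x w) (coords w x) :=
    hF.comp ((measurable_theta_left w).prodMk (measurable_coords_right w))
  have hR : Measurable fun x => ∫⁻ u, F (theta x w) u ∂planeMeasure p w (theta x w) :=
    measurable_lintegral_planeMeasure w hp (F := fun x u => F (theta x w) u)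
      (hF.comp (((measurable_theta_left w).comp measurable_fst).prodMk measurable_snd))
  -- After multiplication by `∫⁻ u, g u`, it suffices to compare integrals over almost every plane.
  -- There the integrand on the right is constant apart from `p`, so it contributes the plane mass
  -- times that constant.
  rw [lintegral_withDensity_eq_lintegral_mul _ hp hFc,
    lintegral_withDensity_eq_lintegral_mul _ hp hR, ← ENNReal.mul_right_inj hg0 hgt,
    lintegral_mul_lintegral_eq_lintegral_planes w hg (hp.mul hFc),
    lintegral_mul_lintegral_eq_lintegral_planes w hg (hp.mul hR)]
  refine lintegral_congr_ae ?_
  filter_upwards [ae_planeMass_lt_top w hp hfin] with x hx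
  simp only [Pi.mul_apply, theta_planePoint, theta_theta, coords_planePoint, coords_theta,
    zero_add]
  rw [lintegral_mul_const _ (by fun_prop), ← planeMass_mul_lintegral_planeMeasure w hp hx
    (F := F (theta x w)) (hF.comp measurable_prodMk_left)]
  rfl

end Plane

/-! ### Stationary steps of the samplers, reversibility and comparison of gaps. -/

section Sampler

variable {k ℓ : ℕ} (ν : Measure (Stiefel k ℓ)) [IsProbabilityMeasure ν]

theorem lintegral_planeMove
    (κ : Kernel (EuclideanSpace ℝ (Fin k) × Stiefel k ℓ) (EuclideanSpace ℝ (Fin ℓ)))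
    [IsMarkovKernel κ] (x : EuclideanSpace ℝ (Fin k)) {f : EuclideanSpace ℝ (Fin k) → ℝ≥0∞}
    (hf : Measurable f) :
    ∫⁻ x', f x' ∂planeMove ν κ x =
      ∫⁻ w, ∫⁻ u, f (planePoint w (theta x w) u) ∂(κ (x, w)) ∂ν := by
  have hm := measurable_planePoint (k := k) (ℓ := ℓ)
  rw [planeMove, Kernel.lintegral_comp _ _ _ hf, Kernel.lintegral_id_prod hf.lintegral_kernel]
  simp only [Kernel.const_apply]
  refine lintegral_congr fun w => ?_
  rw [Kernel.lintegral_map _ hm _ hf]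
  exact Kernel.lintegral_id_prod (hf.comp hm) κ (x, w)

variable {p : EuclideanSpace ℝ (Fin k) → ℝ≥0∞}
  {H : Stiefel k ℓ → EuclideanSpace ℝ (Fin k) →
    Kernel (EuclideanSpace ℝ (Fin ℓ)) (EuclideanSpace ℝ (Fin ℓ))}

instance isMarkovKernel_hybridHitAndRun (hHprob : ∀ w x, IsMarkovKernel (H w (theta x w)))
    (hHmeas : JointlyMeasurable H) : IsMarkovKernel (hybridHitAndRun ν H hHprob hHmeas) := by
  have := isMarkovKernel_hybridKernel H hHprob hHmeas
  exact isMarkovKernel_planeMove ν (hybridKernel H hHmeas)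

/-- The kernel `(x, u) ↦ H_{w,θ(x,w)}(u, ·)` for a fixed frame `w`. -/
def frameKernel (hHmeas : JointlyMeasurable H) (w : Stiefel k ℓ) :
    Kernel (EuclideanSpace ℝ (Fin k) × EuclideanSpace ℝ (Fin ℓ)) (EuclideanSpace ℝ (Fin ℓ)) :=
  ⟨fun q => H w (theta q.1 w) q.2,
    Measure.measurable_of_measurable_coe _ fun B hB =>
      (hHmeas B hB).comp (measurable_fst.prodMk (measurable_const.prodMk measurable_snd))⟩

theorem isMarkovKernel_frameKernel (hHprob : ∀ w x, IsMarkovKernel (H w (theta x w)))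
    (hHmeas : JointlyMeasurable H) (w : Stiefel k ℓ) : IsMarkovKernel (frameKernel hHmeas w) :=
  ⟨fun q => (hHprob w q.1).isProbabilityMeasure q.2⟩

/-- A stationary transition of the hybrid sampler is a stationary transition of `H` in a random
plane. -/
theorem lintegral_lintegral_hybridHitAndRun (hp : Measurable p) (hfin : ∫⁻ x, p x ≠ ∞)
    (hHprob : ∀ w x, IsMarkovKernel (H w (theta x w))) (hHmeas : JointlyMeasurable H)
    {Ψ : EuclideanSpace ℝ (Fin k) → EuclideanSpace ℝ (Fin k) → ℝ≥0∞}
    (hΨ : Measurable (Function.uncurry Ψ)) :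
    ∫⁻ x, ∫⁻ x', Ψ x x' ∂hybridHitAndRun ν H hHprob hHmeas x ∂volume.withDensity p =
      ∫⁻ w, ∫⁻ x, ∫⁻ u, ∫⁻ u', Ψ (planePoint w (theta x w) u) (planePoint w (theta x w) u')
        ∂H w (theta x w) u ∂planeMeasure p w (theta x w) ∂volume.withDensity p ∂ν := by
  have := isMarkovKernel_hybridKernel H hHprob hHmeas
  have hmeas : Measurable fun q : EuclideanSpace ℝ (Fin k) × Stiefel k ℓ =>
      ∫⁻ u, Ψ q.1 (planePoint q.2 (theta q.1 q.2) u) ∂hybridKernel H hHmeas q :=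
    Measurable.lintegral_kernel_prod_right
      (f := fun (q : EuclideanSpace ℝ (Fin k) × Stiefel k ℓ) u =>
        Ψ q.1 (planePoint q.2 (theta q.1 q.2) u))
      (hΨ.comp ((measurable_fst.comp measurable_fst).prodMk measurable_planePoint))
  have hstep (x) : ∫⁻ x', Ψ x x' ∂hybridHitAndRun ν H hHprob hHmeas x =
      ∫⁻ w, ∫⁻ u, Ψ x (planePoint w (theta x w) u) ∂hybridKernel H hHmeas (x, w) ∂ν :=
    lintegral_planeMove ν (hybridKernel H hHmeas) x (hΨ.comp measurable_prodMk_left)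
  simp_rw [hstep]
  rw [lintegral_lintegral_swap hmeas.aemeasurable]
  refine lintegral_congr fun w => ?_
  have := isMarkovKernel_frameKernel hHprob hHmeas w
  -- For fixed `w`, the integrand is a function of `theta x w` and `coords w x`, because these two
  -- determine `x`. `frameKernel` projects its base point again, which is harmless by `theta_theta`.
  have hF : Measurable (Function.uncurry fun (y : EuclideanSpace ℝ (Fin k))
      (u : EuclideanSpace ℝ (Fin ℓ)) => ∫⁻ u', Ψ (planePoint w y u) (planePoint w y u')
        ∂frameKernel hHmeas w (y, u)) :=
    Measurable.lintegral_kernel_prod_right (κ := frameKernel hHmeas w)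
      (f := fun q u' => Ψ (planePoint w q.1 q.2) (planePoint w q.1 u'))
      (hΨ.comp (by fun_prop : Measurable fun z : (_ × _) × _ =>
        (planePoint w z.1.1 z.1.2, planePoint w z.1.1 z.2)))
  have h := lintegral_theta_coords w hp hfin hF
  simp only [frameKernel, Kernel.coe_mk, theta_theta, planePoint_theta_coords] at h
  exact h

theorem isReversible_hybridHitAndRun (hp : Measurable p) (hfin : ∫⁻ x, p x ≠ ∞)
    (hHprob : ∀ w x, IsMarkovKernel (H w (theta x w))) (hHmeas : JointlyMeasurable H)
    (hHrev : ∀ w x, GoodPlane p w (theta x w) →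
      (H w (theta x w)).IsReversible (planeMeasure p w (theta x w))) :
    (hybridHitAndRun ν H hHprob hHmeas).IsReversible (volume.withDensity p) := by
  -- Rewrites each side of detailed balance as the mean of a product of two indicators over one
  -- step, the form to which the plane decomposition applies.
  have key {Ω : Type _} [MeasurableSpace Ω] (K : Kernel Ω Ω) (ρ : Measure Ω) {A B : Set Ω}
      (hA : MeasurableSet A) (hB : MeasurableSet B) :
      ∫⁻ x in A, K x B ∂ρ =
        ∫⁻ x, ∫⁻ x', A.indicator (fun _ => B.indicator 1 x') x ∂K x ∂ρ := by
    rw [← lintegral_indicator hA]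
    refine lintegral_congr fun x => ?_
    by_cases hx : x ∈ A <;> simp [hx, lintegral_indicator_one hB]
  have hmeas {A B : Set (EuclideanSpace ℝ (Fin k))} (hA : MeasurableSet A)
      (hB : MeasurableSet B) : Measurable (Function.uncurry
        fun x x' => A.indicator (fun _ => B.indicator (1 : EuclideanSpace ℝ (Fin k) → ℝ≥0∞) x') x) :=
    Measurable.indicator ((measurable_one.indicator hB).comp measurable_snd)
      (measurable_fst hA)
  intro A B hA hB
  rw [key _ _ hA hB, key _ _ hB hA,
    lintegral_lintegral_hybridHitAndRun ν hp hfin hHprob hHmeas (hmeas hA hB),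
    lintegral_lintegral_hybridHitAndRun ν hp hfin hHprob hHmeas (hmeas hB hA)]
  refine lintegral_congr fun w => lintegral_congr_ae ?_
  filter_upwards [ae_goodPlane w hp hfin] with x hx
  have hm : Measurable fun u => planePoint w (theta x w) u := by fun_prop
  have h := hHrev w x hx (hm hA) (hm hB)
  rwa [key _ _ (hm hA) (hm hB), key _ _ (hm hB) (hm hA)] at h

theorem energy_hybridHitAndRun (hp : Measurable p) (hfin : ∫⁻ x, p x ≠ ∞)
    (hHprob : ∀ w x, IsMarkovKernel (H w (theta x w))) (hHmeas : JointlyMeasurable H)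
    {f : EuclideanSpace ℝ (Fin k) → ℝ} (hf : Measurable f) :
    energy (hybridHitAndRun ν H hHprob hHmeas) (volume.withDensity p) f =
      ∫⁻ w, ∫⁻ x, energy (H w (theta x w)) (planeMeasure p w (theta x w))
        (fun u => f (planePoint w (theta x w) u)) ∂volume.withDensity p ∂ν :=
  lintegral_lintegral_hybridHitAndRun ν hp hfin hHprob hHmeas
    (Ψ := fun x x' => ‖f x - f x'‖ₑ ^ 2) (by unfold Function.uncurry; fun_prop)

theorem jointlyMeasurable_const_planeMeasure (hp : Measurable p) :
    JointlyMeasurable fun (w : Stiefel k ℓ) y =>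
      Kernel.const (EuclideanSpace ℝ (Fin ℓ)) (planeMeasure p w y) := by
  intro B hB
  simp only [Kernel.const_apply]
  have h := (planeKernel (ℓ := ℓ) p hp).measurable_coe hB
  exact h.comp (f := fun q : EuclideanSpace ℝ (Fin k) × Stiefel k ℓ × EuclideanSpace ℝ (Fin ℓ) =>
    (q.1, q.2.1)) (by fun_prop)

/-- Lets every statement about the hybrid sampler be reused for the ideal one. -/
theorem idealHitAndRun_eq_hybridHitAndRun (hp : Measurable p) :
    idealHitAndRun ν p hp =
      hybridHitAndRun ν (fun w y => Kernel.const _ (planeMeasure p w y))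
        (fun _ _ => inferInstance) (jointlyMeasurable_const_planeMeasure hp) :=
  rfl

theorem isReversible_const {Ω : Type*} [MeasurableSpace Ω] (ρ : Measure Ω) :
    (Kernel.const Ω ρ).IsReversible ρ := fun A B _ _ => by
  simp [mul_comm]

theorem isReversible_idealHitAndRun (hp : Measurable p) (hfin : ∫⁻ x, p x ≠ ∞) :
    (idealHitAndRun ν p hp).IsReversible (volume.withDensity p) := by
  rw [idealHitAndRun_eq_hybridHitAndRun]
  exact isReversible_hybridHitAndRun ν hp hfin _ _ fun w x _ => isReversible_const _

/-- Disintegrating the finite integral of `‖f‖ₑ ^ 2` leaves a finite integral in almost every plane,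
as the Poincaré inequality there requires. -/
theorem ae_memLp_planePoint (hp : Measurable p) (hfin : ∫⁻ x, p x ≠ ∞) (w : Stiefel k ℓ)
    {f : EuclideanSpace ℝ (Fin k) → ℝ} (hf : Measurable f)
    (hf2 : MemLp f 2 (volume.withDensity p)) :
    ∀ᵐ x ∂volume.withDensity p,
      MemLp (fun u => f (planePoint w (theta x w) u)) 2 (planeMeasure p w (theta x w)) := by
  have hF : Measurable (Function.uncurry fun (y : EuclideanSpace ℝ (Fin k))
      (u : EuclideanSpace ℝ (Fin ℓ)) => ‖f (planePoint w y u)‖ₑ ^ 2) := by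
    unfold Function.uncurry
    fun_prop
  have hF' : Measurable (Function.uncurry fun (x : EuclideanSpace ℝ (Fin k))
      (u : EuclideanSpace ℝ (Fin ℓ)) => ‖f (planePoint w (theta x w) u)‖ₑ ^ 2) := by
    unfold Function.uncurry
    fun_prop
  have h := lintegral_theta_coords w hp hfin hF
  simp only [planePoint_theta_coords] at h
  have h2 := (eLpNorm_lt_top_iff_lintegral_rpow_enorm_lt_top two_ne_zero
    ENNReal.ofNat_ne_top).1 hf2.2
  simp only [ENNReal.toReal_ofNat, ENNReal.rpow_two] at h2
  rw [h] at h2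
  filter_upwards [ae_lt_top (measurable_lintegral_planeMeasure w hp hF') h2.ne] with x hx
  refine ⟨Measurable.aestronglyMeasurable (by fun_prop), ?_⟩
  rw [eLpNorm_lt_top_iff_lintegral_rpow_enorm_lt_top two_ne_zero ENNReal.ofNat_ne_top]
  simpa only [ENNReal.toReal_ofNat, ENNReal.rpow_two] using hx

theorem mul_gap_idealHitAndRun_le_gap (hp : Measurable p)
    [IsProbabilityMeasure (volume.withDensity p)]
    (hHprob : ∀ w x, IsMarkovKernel (H w (theta x w))) (hHmeas : JointlyMeasurable H)
    (hHrev : ∀ w x, GoodPlane p w (theta x w) →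
      (H w (theta x w)).IsReversible (planeMeasure p w (theta x w)))
    {γ : ℝ} (hγ0 : 0 ≤ γ)
    (hγ : ∀ᵐ w ∂ν, ∀ᵐ x ∂volume.withDensity p,
      γ ≤ gap (H w (theta x w)) (planeMeasure p w (theta x w))) :
    γ * gap (idealHitAndRun ν p hp) (volume.withDensity p) ≤
      gap (hybridHitAndRun ν H hHprob hHmeas) (volume.withDensity p) := by
  have hfin : ∫⁻ x, p x ≠ ∞ := by
    rw [← setLIntegral_univ, ← withDensity_apply _ MeasurableSet.univ, measure_univ]
    exact ENNReal.one_ne_top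
  have hI := (isReversible_idealHitAndRun ν hp hfin)
  rw [idealHitAndRun_eq_hybridHitAndRun] at hI ⊢
  refine mul_gap_le_gap
    (isReversible_hybridHitAndRun ν hp hfin hHprob hHmeas hHrev).invariant
    hI.invariant hγ0 fun f => ?_
  have hf : Measurable f := (Lp.stronglyMeasurable f).measurable
  rw [energy_hybridHitAndRun ν hp hfin _ _ hf, energy_hybridHitAndRun ν hp hfin _ _ hf,
    ← lintegral_const_mul' _ _ ENNReal.ofReal_ne_top]
  refine lintegral_mono_ae ?_
  filter_upwards [hγ] with w hw
  -- A finite constant moves inside the integral without any measurability of the plane energies.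
  rw [← lintegral_const_mul' _ _ ENNReal.ofReal_ne_top]
  refine lintegral_mono_ae ?_
  filter_upwards [hw, ae_goodPlane w hp hfin, ae_memLp_planePoint hp hfin w hf (Lp.memLp f)]
    with x h₁ h₂ h₃
  have := hHprob w x
  exact mul_energy_const_le_energy (hHrev w x h₂).invariant hγ0 h₁ (by fun_prop) h₃

theorem ae_gap_nonneg (μ : Measure (Stiefel k ℓ)) [SFinite μ] (hp : Measurable p) (hfin : ∫⁻ x, p x ≠ ∞)
    (hHprob : ∀ w x, IsMarkovKernel (H w (theta x w)))
    (hHrev : ∀ w x, GoodPlane p w (theta x w) →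
      (H w (theta x w)).IsReversible (planeMeasure p w (theta x w))) :
    ∀ᵐ z ∂μ.prod (volume.withDensity p),
      0 ≤ gap (H z.1 (theta z.2 z.1)) (planeMeasure p z.1 (theta z.2 z.1)) := by
  have hm : Measurable fun z : Stiefel k ℓ × EuclideanSpace ℝ (Fin k) =>
      planeMass p z.1 (theta z.2 z.1) :=
    (Measurable.lintegral_prod_right' (hp.comp measurable_planePoint)).comp measurable_swap
  have hg : MeasurableSet {z : Stiefel k ℓ × EuclideanSpace ℝ (Fin k) |
      GoodPlane p z.1 (theta z.2 z.1)} :=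
    (measurableSet_lt measurable_const hm).inter (measurableSet_lt hm measurable_const)
  -- Passing from almost every `x` for each `w` to almost every pair needs a measurable set; it is
  -- done for good planes, since the gap is not known to be measurable.
  have h := (Measure.ae_prod_iff_ae_ae (μ := μ) (ν := volume.withDensity p) hg).2
    (Filter.Eventually.of_forall fun w => ae_goodPlane w hp hfin)
  filter_upwards [h] with z hz
  have := hHprob z.1 z.2
  exact gap_nonneg (hHrev z.1 z.2 hz).invariant

end Sampler

end HitAndRun

end

theorem mainTheorem3 (k ℓ : ℕ) (hℓ : 1 ≤ ℓ) (hℓk : ℓ ≤ k)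
    (p : EuclideanSpace ℝ (Fin k) → ℝ≥0∞) (hp : Measurable p)
    (π : Measure (EuclideanSpace ℝ (Fin k))) [IsProbabilityMeasure π]
    (hπ : π = volume.withDensity p)
    (ν : Measure (HitAndRun.Stiefel k ℓ)) [IsProbabilityMeasure ν]
    (H : HitAndRun.Stiefel k ℓ → EuclideanSpace ℝ (Fin k) →
      Kernel (EuclideanSpace ℝ (Fin ℓ)) (EuclideanSpace ℝ (Fin ℓ)))
    (hHprob : ∀ w x, IsMarkovKernel (H w (HitAndRun.theta x w)))
    (hHmeas : HitAndRun.JointlyMeasurable H)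
    (hHrev : ∀ w x, HitAndRun.GoodPlane p w (HitAndRun.theta x w) →
      (H w (HitAndRun.theta x w)).IsReversible
        (HitAndRun.planeMeasure p w (HitAndRun.theta x w))) :
    (HitAndRun.hybridHitAndRun ν H hHprob hHmeas).IsReversible π ∧
    (HitAndRun.idealHitAndRun ν p hp).IsReversible π ∧
    HitAndRun.gap (HitAndRun.hybridHitAndRun ν H hHprob hHmeas) π ≥
      essInf (fun z : HitAndRun.Stiefel k ℓ × EuclideanSpace ℝ (Fin k) =>
        HitAndRun.gap (H z.1 (HitAndRun.theta z.2 z.1))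
          (HitAndRun.planeMeasure p z.1 (HitAndRun.theta z.2 z.1))) (ν.prod π) *
      HitAndRun.gap (HitAndRun.idealHitAndRun ν p hp) π := by
  have hfin : ∫⁻ x, p x ≠ ∞ := by
    rw [← setLIntegral_univ, ← withDensity_apply _ MeasurableSet.univ, ← hπ, measure_univ]
    exact ENNReal.one_ne_top
  subst hπ
  refine ⟨HitAndRun.isReversible_hybridHitAndRun ν hp hfin hHprob hHmeas hHrev,
    HitAndRun.isReversible_idealHitAndRun ν hp hfin, ?_⟩
  -- The real-valued `essInf` is a supremum of almost-everywhere lower bounds. That `0` is one of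
  -- them makes it a genuine lower bound and nonnegative.
  have h0 := HitAndRun.ae_gap_nonneg ν hp hfin hHprob hHrev
  refine HitAndRun.mul_gap_idealHitAndRun_le_gap ν hp hHprob hHmeas hHrev ?_
    (Measure.ae_ae_of_ae_prod (ae_essInf_le ⟨0, h0⟩))
  rw [essInf, Filter.liminf_eq]
  exact Real.sSup_nonneg' ⟨0, h0, le_rfl⟩
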